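/- Let $\Sigma$ be a structured network system $\dot x = Ax + Bu$ with $n$ scalar states and $m$ scalar inputs: the diagonal of $A\in\mathbb{R}^{n\times n}$ is zero (trivial internal dynamics), each off-diagonal entry $A_{ij}$ is either a free real parameter (if subsystem $j$ is connected to subsystem $i$) or fixed to zero, and each entry of $B\in\mathbb{R}^{n\times m}$ is either a free real parameter or fixed to zero. $\Sigma$ is structurally controllable if for some choice of the free parameters the matrix $[B\ AB\ \cdots\ A^{n-1}B]$ has full row rank. Let $\mathrm{G}(\Sigma)$ be the directed graph with state nodes $x_1,\dots,x_n$, input nodes $u_1,\dots,u_m$, an edge $(x_j,x_i)$ for each free entry $A_{ij}$ and an edge $(u_s,x_i)$ for each free entry $B_{is}$. A stem is a directed path with distinct nodes from an input node to a state node; a cycle is an elementary directed cycle (its nodes are distinct, it has at least one edge, and it does not depend on the choice of the starting node). $\Sigma$ is input-accessible if every state node is the end node of a stem. If $\Sigma$ is input-accessible, then $\Sigma$ is not structurally controllable if and only if every set of stems and cycles of $\mathrm{G}(\Sigma)$ that covers all state nodes includes at least one of the following: (1) a stem and a cycle that share a node; (2) two distinct cycles that share a node; (3) two stems that originate from different input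 nodes and share a node; (4) two distinct stems that originate from the same input node. -/

import Mathlib

/-- A structured network system with `n` scalar subsystems and `m` scalar inputs:
`G₀.Adj j i` means that subsystem `j` may influence subsystem `i`, and `inputs s i` means that
the `s`-th input directly affects subsystem `i`. -/
structure NetworkSystem (n m : ℕ) where
  /-- The interconnection graph of the subsystems. -/
  G₀ : Digraph (Fin n)
  /-- The pattern of the input matrix. -/
  inputs : Fin m → Fin n → Prop

namespace NetworkSystem

variable {n m : ℕ} (N : NetworkSystem n m)

/-- `(A, B)` is a numerical realization: the entry `A i j` with `j ≠ i` is free if `(j, i)` is an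
edge of the interconnection graph and zero otherwise, the diagonal of `A` is zero (trivial
internal dynamics), and `B i s` is free if input `s` affects subsystem `i` and zero otherwise. -/
def IsRealization (A : Matrix (Fin n) (Fin n) ℝ) (B : Matrix (Fin n) (Fin m) ℝ) : Prop :=
  (∀ i, A i i = 0) ∧ (∀ i j, ¬ N.G₀.Adj j i → A i j = 0) ∧ (∀ i s, ¬ N.inputs s i → B i s = 0)

/-- The controllability matrix `[B  AB  ⋯  A^(n-1) B]`; the column `(k, s)` is the `s`-th column
of the block `A ^ k * B`. -/
def controllabilityMatrix (A : Matrix (Fin n) (Fin n) ℝ) (B : Matrix (Fin n) (Fin m) ℝ) :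
    Matrix (Fin n) (Fin n × Fin m) ℝ :=
  Matrix.of fun i ks => (A ^ (ks.1 : ℕ) * B) i ks.2

/-- Some numerical realization has a controllability matrix of full row rank. -/
def StructurallyControllable : Prop :=
  ∃ (A : Matrix (Fin n) (Fin n) ℝ) (B : Matrix (Fin n) (Fin m) ℝ),
    N.IsRealization A B ∧ (controllabilityMatrix A B).rank = n

/-- The directed graph of the system. Its vertices are the state nodes `Sum.inl i` and the input
nodes `Sum.inr s`; its edges follow the entries of `A` and `B` that are not fixed to zero. -/
def graph : Digraph (Fin n ⊕ Fin m) where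
  Adj
    | .inl j, .inl i => j ≠ i ∧ N.G₀.Adj j i
    | .inr s, .inl i => N.inputs s i
    | _, .inr _ => False

/-- `p` is a stem originated from the input node `s`: a sequence of distinct nodes, successive
ones joined by edges, that begins at the input node `s` and ends at a state node. -/
def IsStemFrom (s : Fin m) (p : List (Fin n ⊕ Fin m)) : Prop :=
  p.Nodup ∧ p.IsChain N.graph.Adj ∧ p.head? = some (Sum.inr s) ∧
    ∃ i : Fin n, p.getLast? = some (Sum.inl i)

/-- `p` is a stem. -/
def IsStem (p : List (Fin n ⊕ Fin m)) : Prop :=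
  ∃ s, N.IsStemFrom s p

/-- `c` is an elementary cycle: a nonempty cyclic sequence of distinct nodes in which every node
is joined by an edge to the next one (and the last one to the first one). Sequences that differ
only in the choice of the starting node are the same cycle. -/
def IsElementaryCycle (c : Cycle (Fin n ⊕ Fin m)) : Prop :=
  c ≠ Cycle.nil ∧ c.Nodup ∧ c.Chain N.graph.Adj

/-- Every state node is the end node of a stem. -/
def InputAccessible : Prop :=
  ∀ i : Fin n, ∃ p, N.IsStem p ∧ p.getLast? = some (Sum.inl i)

/-- The set of the stems in `S` and the elementary cycles in `C` covers the state nodes. -/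
def IsStemCycleCover (S : Set (List (Fin n ⊕ Fin m))) (C : Set (Cycle (Fin n ⊕ Fin m))) : Prop :=
  (∀ p ∈ S, N.IsStem p) ∧ (∀ c ∈ C, N.IsElementaryCycle c) ∧
    ∀ i : Fin n, (∃ p ∈ S, Sum.inl i ∈ p) ∨ (∃ c ∈ C, Sum.inl i ∈ c)

end NetworkSystem

open Function

namespace NetworkSystem

variable {n m : ℕ} (N : NetworkSystem n m)

/-! Both sides are governed by a permutation σ of all nodes that enters every state node along an
edge. A conflict-free cover gives distinct state nodes distinct predecessors, hence σ. Conversely,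
the orbits of σ, cut at the input nodes, form a conflict-free cover.

If the system is controllable, the rows of `[A B]` are independent, and Hall's theorem picks
distinct columns with nonzero entries, which again gives σ.

For the converse, weight the edges of σ by positive constants, distinct on distinct orbits.
Accessibility lets a unit edge from a node of smaller level be added into the lowest node of each
orbit, if that is a state node. The orbits then form a forest. By `eq_zero_of_forest_of_cycles`, no
nonzero left eigenvector of `A` is killed by `B`: distinct weights confine its support to one path
of orbits, and the lowest orbit on that path contradicts the equation at its parent. The eigenvector
test then gives controllability. -/

/-- A permutation of the nodes that moves along an edge whenever it arrives at a state node. -/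
def IsSuccessorPerm (σ : Equiv.Perm (Fin n ⊕ Fin m)) : Prop :=
  ∀ u i, σ u = Sum.inl i → N.graph.Adj u (Sum.inl i)

/-- Two of the given stems and cycles meet, or two distinct stems have the same origin. -/
def HasConflict (S : Set (List (Fin n ⊕ Fin m))) (C : Set (Cycle (Fin n ⊕ Fin m))) : Prop :=
  (∃ p ∈ S, ∃ c ∈ C, ∃ w, w ∈ p ∧ w ∈ c) ∨
  (∃ c ∈ C, ∃ c' ∈ C, c ≠ c' ∧ ∃ w, w ∈ c ∧ w ∈ c') ∨
  (∃ p ∈ S, ∃ p' ∈ S, ∃ s s', s ≠ s' ∧ N.IsStemFrom s p ∧ N.IsStemFrom s' p' ∧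
    ∃ w, w ∈ p ∧ w ∈ p') ∨
  (∃ p ∈ S, ∃ p' ∈ S, p ≠ p' ∧ ∃ s, N.IsStemFrom s p ∧ N.IsStemFrom s p')

/-- A partial injection of a finite set extends to a permutation; the added values are input nodes,
where nothing is required. -/
theorem exists_isSuccessorPerm_of_injective (f : Fin n → Fin n ⊕ Fin m) (hf : Injective f)
    (hadj : ∀ i, N.graph.Adj (f i) (Sum.inl i)) : ∃ σ, N.IsSuccessorPerm σ := by
  obtain ⟨σ, hσ⟩ := Equiv.Perm.exists_extending_pair f (Sum.inl : Fin n → Fin n ⊕ Fin m) hf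
    Sum.inl_injective
  refine ⟨σ, fun u i hu => ?_⟩
  have : u = f i := σ.injective (hu.trans (hσ i).symm)
  exact this ▸ hadj i

/-! ### From a conflict-free cover to a permutation -/

/-- `x` immediately precedes `y` in the list `p`. -/
def Precedes {α : Type*} (p : List α) (x y : α) : Prop :=
  ∃ k, p[k]? = some x ∧ p[k + 1]? = some y

theorem Precedes.eq {α : Type*} {p : List α} (hp : p.Nodup) {x y z : α}
    (h : Precedes p x y) (h' : Precedes p x z) : y = z := by
  obtain ⟨k, hk, hk'⟩ := h
  obtain ⟨l, hl, hl'⟩ := h'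
  have hlt : k < p.length := (List.getElem?_eq_some_iff.1 hk).1
  have : k = l := (List.getElem?_inj hlt hp).1 (hk.trans hl.symm)
  subst this
  exact Option.some.inj (hk'.symm.trans hl')

theorem Precedes.mem {α : Type*} {p : List α} {x y : α} (h : Precedes p x y) : x ∈ p := by
  obtain ⟨k, hk, -⟩ := h
  exact List.mem_of_getElem? hk

theorem Precedes.rel {α : Type*} {r : α → α → Prop} {p : List α} (hp : p.IsChain r) {x y : α}
    (h : Precedes p x y) : r x y := by
  obtain ⟨k, hk, hk'⟩ := h
  obtain ⟨h1, rfl⟩ := List.getElem?_eq_some_iff.1 hk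
  obtain ⟨h2, rfl⟩ := List.getElem?_eq_some_iff.1 hk'
  exact List.isChain_iff_getElem.1 hp k h2

theorem exists_precedes {α : Type*} {p : List α} {y : α} (hy : y ∈ p) (hh : p.head? ≠ some y) :
    ∃ x, Precedes p x y := by
  obtain ⟨k, hk, rfl⟩ := List.mem_iff_getElem.1 hy
  rcases k with _ | k
  · exact absurd (by simp [List.head?_eq_getElem?, hk]) hh
  · exact ⟨p[k], k, by simp, by simp⟩

theorem cycle_rel_next {α : Type*} [DecidableEq α] {r : α → α → Prop} {c : Cycle α}
    (hc : c.Nodup) (hr : c.Chain r) {x : α} (hx : x ∈ c) : r x (c.next hc x hx) := by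
  obtain ⟨l, rfl⟩ : ∃ l : List α, (l : Cycle α) = c := Quot.exists_rep c
  obtain ⟨s, t, rfl⟩ := List.append_of_mem (Cycle.mem_coe_iff.1 hx)
  have hrot : ((s ++ x :: t : List α) : Cycle α) = ((x :: t ++ s : List α) : Cycle α) :=
    Cycle.coe_eq_coe.2 List.isRotated_append
  have key : ∀ (l : List α) (h : x ∈ x :: l), (x :: (l ++ [x])).IsChain r →
      r x (List.next (x :: l) x h) := by
    rintro (_ | ⟨y, l⟩) h hl
    · simpa using hl
    · rw [List.next_cons_cons_eq]
      exact (List.isChain_cons_cons.1 hl).1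
  revert hc hr hx
  rw [hrot]
  intro hc hr hx
  exact key (t ++ s) List.mem_cons_self hr

theorem exists_isSuccessorPerm_of_cover {S : Set (List (Fin n ⊕ Fin m))}
    {C : Set (Cycle (Fin n ⊕ Fin m))} (hSC : N.IsStemCycleCover S C)
    (hnc : ¬ N.HasConflict S C) : ∃ σ, N.IsSuccessorPerm σ := by
  obtain ⟨hS, hC, hcov⟩ := hSC
  simp only [HasConflict, not_or] at hnc
  obtain ⟨h1, h2, h3, h4⟩ := hnc
  have key : ∀ i : Fin n, ∃ x : Fin n ⊕ Fin m, (∃ p ∈ S, Precedes p x (Sum.inl i)) ∨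
      ∃ c ∈ C, ∃ (hc : c.Nodup) (hx : x ∈ c), c.next hc x hx = Sum.inl i := by
    intro i
    rcases hcov i with ⟨p, hp, hi⟩ | ⟨c, hc, hi⟩
    · obtain ⟨s, -, -, hh, -⟩ := hS p hp
      obtain ⟨x, hx⟩ := exists_precedes hi (by simp [hh])
      exact ⟨x, Or.inl ⟨p, hp, hx⟩⟩
    · have hnd := (hC c hc).2.1
      exact ⟨c.prev hnd _ hi, Or.inr ⟨c, hc, hnd, Cycle.prev_mem _ _ _ _,
        Cycle.next_prev _ _ _ _⟩⟩
  choose f hf using key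
  refine N.exists_isSuccessorPerm_of_injective f ?_ ?_
  · intro i j hij
    apply Sum.inl_injective (β := Fin m)
    have hi := hf i
    have hj := hf j
    rw [← hij] at hj
    rcases hi with ⟨p, hp, hpi⟩ | ⟨c, hc, hnd, hx, hci⟩ <;>
    rcases hj with ⟨p', hp', hpj⟩ | ⟨c', hc', hnd', hx', hcj⟩
    · obtain ⟨s, hs⟩ := hS p hp
      obtain ⟨s', hs'⟩ := hS p' hp'
      have hss : s = s' := by
        by_contra hne
        exact h3 ⟨p, hp, p', hp', s, s', hne, hs, hs', _, hpi.mem, hpj.mem⟩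
      subst hss
      have hpp : p = p' := by
        by_contra hne
        exact h4 ⟨p, hp, p', hp', hne, s, hs, hs'⟩
      subst hpp
      exact hpi.eq hs.1 hpj
    · exact absurd ⟨p, hp, c', hc', _, hpi.mem, hx'⟩ h1
    · exact absurd ⟨p', hp', c, hc, _, hpj.mem, hx⟩ h1
    · have hcc : c = c' := by
        by_contra hne
        exact h2 ⟨c, hc, c', hc', hne, _, hx, hx'⟩
      subst hcc
      exact hci.symm.trans hcj
  · intro i
    rcases hf i with ⟨p, hp, hpi⟩ | ⟨c, hc, hnd, hx, hci⟩
    · obtain ⟨s, hs⟩ := hS p hp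
      exact hpi.rel hs.2.1
    · rw [← hci]
      exact cycle_rel_next hnd (hC c hc).2.2 hx

/-! ### From a permutation to a conflict-free cover -/

theorem exists_iterate_iterate_eq {α : Type*} [Finite α] (σ : Equiv.Perm α) (a : ℕ) (y : α) :
    ∃ k, σ^[k] (σ^[a] y) = y := by
  obtain ⟨k, -, hk⟩ := Equiv.Perm.SameCycle.exists_pow_eq'
    (show σ.SameCycle ((σ ^ a) y) y from ⟨-a, by simp⟩)
  refine ⟨k, ?_⟩
  simpa only [Equiv.Perm.iterate_eq_pow] using hk

theorem exists_iterate_isRight (σ : Equiv.Perm (Fin n ⊕ Fin m)) (s : Fin m) :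
    ∃ j, 1 ≤ j ∧ (σ^[j] (Sum.inr s)).isRight := by
  obtain ⟨k, hk⟩ := exists_iterate_iterate_eq σ 1 (Sum.inr s)
  refine ⟨k + 1, by omega, ?_⟩
  rw [iterate_add_apply, hk]
  rfl

/-- The number of steps from an input node to the next input node on its orbit. -/
def stemLength (σ : Equiv.Perm (Fin n ⊕ Fin m)) (s : Fin m) : ℕ :=
  Nat.find (exists_iterate_isRight σ s)

theorem one_le_stemLength (σ : Equiv.Perm (Fin n ⊕ Fin m)) (s : Fin m) : 1 ≤ stemLength σ s :=
  (Nat.find_spec (exists_iterate_isRight σ s)).1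

theorem exists_iterate_eq_inl (σ : Equiv.Perm (Fin n ⊕ Fin m)) {s : Fin m} {j : ℕ}
    (hj : 1 ≤ j) (hlt : j < stemLength σ s) : ∃ i, σ^[j] (Sum.inr s) = Sum.inl i := by
  have := Nat.find_min (exists_iterate_isRight σ s) hlt
  rcases h : σ^[j] (Sum.inr s) with i | t
  · exact ⟨i, rfl⟩
  · simp [h, hj] at this

/-- Cancelling the common iterates leaves an input node reached before the stem has ended, so no
step can remain. -/
theorem iterate_inr_inj (σ : Equiv.Perm (Fin n ⊕ Fin m)) {s s' : Fin m} {a b : ℕ}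
    (ha : a < stemLength σ s) (hb : b < stemLength σ s')
    (h : σ^[a] (Sum.inr s) = σ^[b] (Sum.inr s')) : a = b ∧ s = s' := by
  wlog hab : a ≤ b generalizing a b s s'
  · obtain ⟨h1, h2⟩ := this hb ha h.symm (by omega)
    exact ⟨h1.symm, h2.symm⟩
  obtain ⟨d, rfl⟩ := Nat.exists_eq_add_of_le hab
  rw [iterate_add_apply] at h
  have h' := (σ.injective.iterate a) h
  rcases Nat.eq_zero_or_pos d with rfl | hd
  · exact ⟨rfl, Sum.inr_injective h'⟩
  · obtain ⟨i, hi⟩ := exists_iterate_eq_inl σ hd (by omega : d < stemLength σ s')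
    rw [hi] at h'
    exact absurd h' (by simp)

/-- The nodes visited from an input node until the next input node on its orbit. -/
def orbitStem (σ : Equiv.Perm (Fin n ⊕ Fin m)) (s : Fin m) : List (Fin n ⊕ Fin m) :=
  List.iterate σ (Sum.inr s) (stemLength σ s)

theorem head?_orbitStem (σ : Equiv.Perm (Fin n ⊕ Fin m)) (s : Fin m) :
    (orbitStem σ s).head? = some (Sum.inr s) := by
  rw [List.head?_eq_getElem?, orbitStem, List.getElem?_iterate _ _ _ _ (one_le_stemLength σ s)]
  rfl

theorem isStemFrom_orbitStem {σ : Equiv.Perm (Fin n ⊕ Fin m)} (hσ : N.IsSuccessorPerm σ)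
    {s : Fin m} (h2 : 2 ≤ stemLength σ s) : N.IsStemFrom s (orbitStem σ s) := by
  refine ⟨?_, ?_, head?_orbitStem σ s, ?_⟩
  · rw [orbitStem, ← List.range_map_iterate, List.nodup_map_iff_inj_on List.nodup_range]
    intro a ha b hb hab
    exact (iterate_inr_inj σ (List.mem_range.1 ha) (List.mem_range.1 hb) hab).1
  · rw [orbitStem, List.isChain_iff_getElem]
    intro k hk
    rw [List.length_iterate] at hk
    rw [List.getElem_iterate, List.getElem_iterate]
    obtain ⟨i, hi⟩ := exists_iterate_eq_inl σ (by omega) hk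
    rw [hi]
    exact hσ _ _ (by rw [← iterate_succ_apply' σ, hi])
  · obtain ⟨i, hi⟩ := exists_iterate_eq_inl σ (s := s) (j := stemLength σ s - 1) (by omega)
      (by omega)
    refine ⟨i, ?_⟩
    rw [List.getLast?_eq_getElem?, orbitStem, List.length_iterate,
      List.getElem?_iterate _ _ _ _ (by omega), hi]

theorem exists_cover_of_isSuccessorPerm {σ : Equiv.Perm (Fin n ⊕ Fin m)}
    (hσ : N.IsSuccessorPerm σ) : ∃ S C, N.IsStemCycleCover S C ∧ ¬ N.HasConflict S C := by
  have hper : ∀ x, x ∈ periodicPts σ := fun x =>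
    Function.Injective.mem_periodicPts σ.injective x
  have horig : ∀ {s s'}, N.IsStemFrom s (orbitStem σ s') → s' = s := by
    rintro s s' ⟨-, -, hh, -⟩
    rw [head?_orbitStem] at hh
    exact Sum.inr_injective (Option.some.inj hh)
  -- Length 1 is excluded because a stem must end at a state node.
  refine ⟨{p | ∃ s, 2 ≤ stemLength σ s ∧ p = orbitStem σ s},
    {c | ∃ x, (∀ k, (σ^[k] x).isLeft) ∧ c = periodicOrbit σ x}, ⟨?_, ?_, ?_⟩, ?_⟩
  · rintro p ⟨s, hs, rfl⟩
    exact ⟨s, N.isStemFrom_orbitStem hσ hs⟩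
  · rintro c ⟨x, hx, rfl⟩
    refine ⟨fun h => periodicOrbit_eq_nil_iff_not_periodic_pt.1 h (hper x),
      nodup_periodicOrbit, (periodicOrbit_chain' _ (hper x)).2 fun k => ?_⟩
    obtain ⟨i, hi⟩ := Sum.isLeft_iff.1 (hx (k + 1))
    rw [hi]
    exact hσ _ _ (by rw [← iterate_succ_apply' σ, hi])
  · intro i
    by_cases hi : ∀ k, (σ^[k] (Sum.inl i)).isLeft
    · exact Or.inr ⟨_, ⟨_, hi, rfl⟩, self_mem_periodicOrbit (hper _)⟩
    · left
      have hex : ∃ j s, σ^[j] (Sum.inr s) = Sum.inl i := by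
        push Not at hi
        obtain ⟨k, hk⟩ := hi
        obtain ⟨s, hs⟩ := Sum.isRight_iff.1 (Sum.not_isLeft.1 hk)
        obtain ⟨j, hj⟩ := exists_iterate_iterate_eq σ k (Sum.inl i)
        exact ⟨j, s, by rw [← hs, hj]⟩
      classical
      -- The least number of steps selects the last input node before `i`, so its stem reaches `i`.
      obtain ⟨s, hs⟩ := Nat.find_spec hex
      have hmin := fun {j} => Nat.find_min hex (m := j)
      set j := Nat.find hex
      have hj : 1 ≤ j := by
        rcases Nat.eq_zero_or_pos j with h0 | h0
        · simp [h0] at hs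
        · exact h0
      have hlt : j < stemLength σ s := by
        by_contra hge
        obtain ⟨h1, h2⟩ := Nat.find_spec (exists_iterate_isRight σ s)
        change 1 ≤ stemLength σ s at h1
        change (σ^[stemLength σ s] _).isRight at h2
        obtain ⟨t, ht⟩ := Sum.isRight_iff.1 h2
        refine hmin (j := j - stemLength σ s) (by omega) ⟨t, ?_⟩
        rw [← ht, ← iterate_add_apply, Nat.sub_add_cancel (by omega), hs]
      exact ⟨_, ⟨s, by omega, rfl⟩, List.mem_iterate.2 ⟨j, hlt, hs.symm⟩⟩
  · rintro (⟨_, ⟨s, -, rfl⟩, _, ⟨x, hx, rfl⟩, w, hw, hw'⟩ |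
      ⟨_, ⟨x, hx, rfl⟩, _, ⟨y, hy, rfl⟩, hne, w, hw, hw'⟩ |
      ⟨_, ⟨t, -, rfl⟩, _, ⟨t', -, rfl⟩, s, s', hne, hs, hs', w, hw, hw'⟩ |
      ⟨_, ⟨t, -, rfl⟩, _, ⟨t', -, rfl⟩, hne, s, hs, hs'⟩)
    · obtain ⟨a, -, rfl⟩ := List.mem_iterate.1 hw
      obtain ⟨b, hb⟩ := (mem_periodicOrbit_iff (hper x)).1 hw'
      obtain ⟨k, hk⟩ := exists_iterate_iterate_eq σ a (Sum.inr s)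
      have := hx (k + b)
      rw [iterate_add_apply, hb, hk] at this
      simp at this
    · obtain ⟨a, rfl⟩ := (mem_periodicOrbit_iff (hper x)).1 hw
      obtain ⟨b, hb⟩ := (mem_periodicOrbit_iff (hper y)).1 hw'
      apply hne
      rw [← periodicOrbit_apply_iterate_eq (hper x) a, ← hb,
        periodicOrbit_apply_iterate_eq (hper y) b]
    · obtain rfl := horig hs
      obtain rfl := horig hs'
      obtain ⟨a, ha, rfl⟩ := List.mem_iterate.1 hw
      obtain ⟨b, hb, hab⟩ := List.mem_iterate.1 hw'
      exact hne (iterate_inr_inj σ ha hb hab).2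
    · obtain rfl := horig hs
      obtain rfl := horig hs'
      exact hne rfl

/-! ### Controllability yields a permutation -/

open Matrix in
theorem rank_eq_card_iff_forall_vecMul_eq_zero {K ι κ : Type*} [Field K] [Fintype ι] [Fintype κ]
    [DecidableEq ι] (M : Matrix ι κ K) :
    M.rank = Fintype.card ι ↔ ∀ v : ι → K, v ᵥ* M = 0 → v = 0 := by
  have h : LinearIndependent K M.row ↔ ∀ v : ι → K, v ᵥ* M = 0 → v = 0 := by
    rw [← Matrix.vecMul_injective_iff]
    exact injective_iff_map_eq_zero M.vecMulLinear
  rw [← h, linearIndependent_iff_card_eq_finrank_span, Matrix.rank_eq_finrank_span_row, eq_comm]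
  rfl

-- If the rows in `s` had their nonzero entries in fewer than `s.card` columns, they would be
-- dependent; this is Hall's condition.
open Matrix in
theorem exists_injective_ne_zero {K ι κ : Type*} [Field K] [Fintype ι] [Fintype κ]
    (M : Matrix ι κ K) (hM : ∀ v : ι → K, v ᵥ* M = 0 → v = 0) :
    ∃ f : ι → κ, Injective f ∧ ∀ i, M i (f i) ≠ 0 := by
  classical
  have hall := (Finset.all_card_le_biUnion_card_iff_exists_injective
    (fun i => Finset.univ.filter fun x => M i x ≠ 0)).1 ?_
  · obtain ⟨f, hf, hf'⟩ := hall
    exact ⟨f, hf, fun i => by simpa using hf' i⟩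
  intro s
  by_contra! hlt
  set T := s.biUnion fun i => Finset.univ.filter fun x => M i x ≠ 0 with hT
  let F : (s → K) →ₗ[K] (T → K) := (M.submatrix (fun i : s => (i : ι)) (fun x : T => (x : κ))).vecMulLinear
  have hker : LinearMap.ker F ≠ ⊥ := LinearMap.ker_ne_bot_of_finrank_lt (by simpa using hlt)
  obtain ⟨g, hg, hg0⟩ := (Submodule.ne_bot_iff _).1 hker
  apply hg0
  let v : ι → K := fun i => if h : i ∈ s then g ⟨i, h⟩ else 0
  have hsum : ∀ x, (v ᵥ* M) x = ∑ i : s, g i * M i x := by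
    intro x
    simp only [Matrix.vecMul, dotProduct, v]
    rw [← Finset.sum_subset (Finset.subset_univ s) (by intro i _ hi; simp [hi]),
      ← Finset.sum_coe_sort s]
    exact Finset.sum_congr rfl fun i _ => by simp
  have hv : v = 0 := hM v <| by
    ext x
    rw [hsum]
    by_cases hx : x ∈ T
    · exact congrFun (LinearMap.mem_ker.1 hg) ⟨x, hx⟩
    · refine Finset.sum_eq_zero fun i _ => ?_
      have : M i x = 0 := by
        by_contra hne
        exact hx (Finset.mem_biUnion.2 ⟨i, i.2, by simpa using hne⟩)
      rw [this, mul_zero]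
  ext i
  simpa [v] using congrFun hv i

theorem rank_controllabilityMatrix_eq_iff (A : Matrix (Fin n) (Fin n) ℝ)
    (B : Matrix (Fin n) (Fin m) ℝ) :
    (controllabilityMatrix A B).rank = n ↔
      ∀ v : Fin n → ℝ, (∀ k < n, Matrix.vecMul v (A ^ k * B) = 0) → v = 0 := by
  have h := rank_eq_card_iff_forall_vecMul_eq_zero (controllabilityMatrix A B)
  rw [Fintype.card_fin] at h
  rw [h]
  refine forall_congr' fun v => imp_congr_left ⟨fun hv k hk => ?_, fun hv => ?_⟩
  · ext s
    exact congrFun hv (⟨k, hk⟩, s)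
  · ext ks
    exact congrFun (hv ks.1 ks.1.2) ks.2

theorem StructurallyControllable.exists_isSuccessorPerm {N : NetworkSystem n m}
    (h : N.StructurallyControllable) : ∃ σ, N.IsSuccessorPerm σ := by
  obtain ⟨A, B, ⟨hd, hA, hB⟩, hr⟩ := h
  rw [rank_controllabilityMatrix_eq_iff] at hr
  obtain ⟨f, hf, hne⟩ := exists_injective_ne_zero (Matrix.fromCols A B) fun v hv => hr v <| by
    rw [Matrix.vecMul_fromCols] at hv
    have hvA : Matrix.vecMul v A = 0 := by ext i; exact congrFun hv (Sum.inl i)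
    have hvB : Matrix.vecMul v B = 0 := by ext i; exact congrFun hv (Sum.inr i)
    intro k _
    rw [← Matrix.vecMul_vecMul]
    rcases k with _ | k
    · simpa using hvB
    · rw [pow_succ', ← Matrix.vecMul_vecMul, hvA, Matrix.zero_vecMul, Matrix.zero_vecMul]
  refine N.exists_isSuccessorPerm_of_injective f hf fun i => ?_
  have hi := hne i
  revert hi
  rcases f i with j | s <;> intro hi
  · rw [Matrix.fromCols_apply_inl] at hi
    refine ⟨?_, not_imp_comm.1 (hA i j) hi⟩
    rintro rfl
    exact hi (hd j)
  · rw [Matrix.fromCols_apply_inr] at hi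
    exact not_imp_comm.1 (hB i s) hi

/-! ### Eigenvectors of a forest of cycles -/

/-- The eigenvector test for controllability. -/
theorem rank_controllabilityMatrix_eq_of_eigenvector_test (A : Matrix (Fin n) (Fin n) ℝ)
    (B : Matrix (Fin n) (Fin m) ℝ)
    (h : ∀ (μ : ℂ) (v : Fin n → ℂ), Matrix.vecMul v (A.map Complex.ofReal) = μ • v →
      Matrix.vecMul v (B.map Complex.ofReal) = 0 → v = 0) :
    (controllabilityMatrix A B).rank = n := by
  rw [rank_controllabilityMatrix_eq_iff]
  intro y hy
  -- Cayley–Hamilton reduces every power to those below `n`.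
  have hy' : ∀ k, Matrix.vecMul y (A ^ k * B) = 0 := by
    intro k
    rw [Matrix.pow_eq_aeval_mod_charpoly, Polynomial.aeval_eq_sum_range, Matrix.sum_mul,
      Matrix.vecMul_sum]
    refine Finset.sum_eq_zero fun l hl => ?_
    by_cases hl' : l < n
    · rw [Matrix.smul_mul, Matrix.vecMul_smul, hy l hl', smul_zero]
    · have hdeg : (Polynomial.X ^ k %ₘ A.charpoly).coeff l = 0 := by
        refine Polynomial.coeff_eq_zero_of_degree_lt
          ((Polynomial.degree_modByMonic_lt _ A.charpoly_monic).trans_le ?_)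
        rw [Matrix.charpoly_degree_eq_dim, Fintype.card_fin]
        exact_mod_cast not_lt.1 hl'
      rw [hdeg, zero_smul, Matrix.zero_mul, Matrix.vecMul_zero]
  set A' := A.map Complex.ofReal with hA'
  set B' := B.map Complex.ofReal with hB'
  -- This subspace is invariant under `A'`, so if nonzero it contains an eigenvector, and the case
  -- `k = 0` shows that `B'` kills it.
  let W : Submodule ℂ (Fin n → ℂ) := ⨅ k : ℕ, LinearMap.ker (A' ^ k * B').vecMulLinear
  have hW : ∀ v, v ∈ W ↔ ∀ k, Matrix.vecMul v (A' ^ k * B') = 0 := by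
    intro v
    simp [W, Submodule.mem_iInf]
  have hinv : ∀ v ∈ W, A'.vecMulLinear v ∈ W := by
    intro v hv
    rw [hW] at hv ⊢
    intro k
    rw [Matrix.vecMulLinear_apply, Matrix.vecMul_vecMul, ← Matrix.mul_assoc, ← pow_succ']
    exact hv (k + 1)
  have hyW : (fun i => (y i : ℂ)) ∈ W := by
    rw [hW]
    intro k
    have hmap : A' ^ k * B' = (A ^ k * B).map Complex.ofReal := by
      change (Complex.ofRealHom.mapMatrix A) ^ k * B.map Complex.ofRealHom = _
      rw [← map_pow]
      exact (Matrix.map_mul (f := Complex.ofRealHom)).symm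
    rw [hmap]
    ext s
    have := congrArg Complex.ofReal (congrFun (hy' k) s)
    simpa [Matrix.vecMul, dotProduct] using this
  by_contra hy0
  have hWbot : Nontrivial W := by
    refine ⟨⟨⟨_, hyW⟩, 0, fun h0 => hy0 ?_⟩⟩
    ext i
    have := congrFun (congrArg Subtype.val h0) i
    simpa using this
  obtain ⟨μ, hμ⟩ := Module.End.exists_eigenvalue (LinearMap.restrict A'.vecMulLinear hinv)
  obtain ⟨v, hv⟩ := hμ.exists_hasEigenvector
  refine hv.2 (Subtype.ext (h μ v.1 ?_ ?_))
  · exact congrArg Subtype.val hv.apply_eq_smul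
  · simpa using (hW v).1 v.2 0

theorem exists_iterate_transition {α : Type*} (f : α → α) (P : α → Prop) {x : α} (hx : P x) :
    ∀ k, ¬ P (f^[k] x) → ∃ j, P (f^[j] x) ∧ ¬ P (f (f^[j] x))
  | 0, h => absurd hx h
  | k + 1, h => by
    by_cases hk : P (f^[k] x)
    · exact ⟨k, hk, by rwa [← iterate_succ_apply' f]⟩
    · exact exists_iterate_transition f P hx k hk

/-- A weighted permutation of finitely many nodes, with distinct weights on distinct orbits, to
which one edge into each orbit is added, coming from an orbit of smaller level: the only
solution `v` of the left eigenvector equation at all nodes, whose support has parents of smaller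
level, is zero. -/
theorem eq_zero_of_forest_of_cycles {V : Type*} [Fintype V] [DecidableEq V] (σ : Equiv.Perm V)
    (rep par : V → V) (d : V → ℕ) (W : V → ℝ) (v : V → ℂ) (μ : ℂ)
    (hrep : ∀ x, σ.SameCycle x (rep x)) (hrep' : ∀ x y, σ.SameCycle x y → rep x = rep y)
    (hmin : ∀ x, d (rep x) ≤ d x) (hW : Injective W) (hWpos : ∀ x, 0 < W x)
    (hpar : ∀ x, d (par x) ≤ d x) (hpar' : ∀ x, v x ≠ 0 → d (par x) < d x)
    (heq : ∀ u, μ * v u = W (rep u) * v (σ u) +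
      ∑ x with rep x = x ∧ par x = u, v x) : v = 0 := by
  have hiter : ∀ x k, rep (σ^[k] x) = rep x := fun x k => by
    rw [Equiv.Perm.iterate_eq_pow]
    exact (hrep' _ _ ⟨k, by simp⟩).symm
  have hreach : ∀ x y, rep x = rep y → ∃ k, σ^[k] x = y := fun x y h => by
    have hxy : σ.SameCycle x y := (hrep x).trans (h ▸ (hrep y).symm)
    obtain ⟨k, -, hk⟩ := hxy.exists_pow_eq'
    exact ⟨k, by rwa [Equiv.Perm.iterate_eq_pow]⟩
  have hchild : ∀ u, ∑ x with rep x = x ∧ par x = u, v x ≠ 0 →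
      ∃ q, rep q = q ∧ par q = u ∧ v q ≠ 0 := fun u hu => by
    obtain ⟨q, hq, hq0⟩ := Finset.exists_ne_zero_of_sum_ne_zero hu
    simp only [Finset.mem_filter, Finset.mem_univ, true_and] at hq
    exact ⟨q, hq.1, hq.2, hq0⟩
  have hlevel : ∀ q, rep q = q → v q ≠ 0 → d (rep (par q)) < d (rep q) := fun q hq hq0 => by
    rw [hq]
    exact (hmin _).trans_lt (hpar' q hq0)
  -- Without supported children, going once round the orbit multiplies out to μ^k = W^k.
  have hhom : ∀ x, v x ≠ 0 → (∀ q, rep q = q → rep (par q) = rep x → v q = 0) →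
      ‖μ‖ = W (rep x) := by
    intro x hx hno
    have hstep : ∀ k, μ ^ k * v x = (W (rep x) : ℂ) ^ k * v (σ^[k] x) := by
      intro k
      induction k with
      | zero => simp
      | succ k ih =>
        have h := heq (σ^[k] x)
        have h0 : ∑ y with rep y = y ∧ par y = σ^[k] x, v y = 0 := by
          by_contra hne
          obtain ⟨q, hq, hqu, hq0⟩ := hchild _ hne
          exact hq0 (hno q hq (by rw [hqu, hiter]))
        rw [h0, add_zero, hiter] at h
        rw [pow_succ', mul_assoc, ih, mul_left_comm, h, iterate_succ_apply']
        ring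
    obtain ⟨k, hk⟩ := exists_iterate_iterate_eq σ 1 x
    rw [← iterate_add_apply] at hk
    have h := hstep (k + 1)
    rw [hk] at h
    have h' := congrArg norm (mul_right_cancel₀ hx h)
    rw [norm_pow, norm_pow, Complex.norm_real, Real.norm_of_nonneg (hWpos _).le] at h'
    exact (pow_left_inj₀ (norm_nonneg _) (hWpos _).le (Nat.succ_ne_zero k)).1 h'
  by_contra hv
  obtain ⟨x₀, hx₀⟩ : ∃ x, v x ≠ 0 := by
    by_contra! h
    exact hv (funext h)
  obtain ⟨z, hz0, hzmax⟩ := Set.exists_max_image {x | v x ≠ 0} (fun x => d (rep x))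
    (Set.toFinite _) ⟨x₀, hx₀⟩
  have hμ : ‖μ‖ = W (rep z) := hhom z hz0 fun q hq hqz => by
    by_contra hq0
    have h1 := hlevel q hq hq0
    have h2 := hzmax q hq0
    rw [hqz] at h1
    exact absurd h2 (not_le.2 h1)
  have hμ0 : μ ≠ 0 := norm_pos_iff.1 (hμ ▸ hWpos _)
  set f : V → V := fun x => rep (par x) with hf
  -- Among supported orbits that are not ancestors of `rep z`, a highest one has no supported child,
  -- so its weight is also ‖μ‖, against injectivity of `W`.
  have hanc : ∀ x, v x ≠ 0 → ∃ k, f^[k] (rep z) = rep x := by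
    by_contra! hbad
    obtain ⟨x, ⟨hx0, hx⟩, hxmax⟩ := Set.exists_max_image
      {x | v x ≠ 0 ∧ ∀ k, f^[k] (rep z) ≠ rep x} (fun x => d (rep x)) (Set.toFinite _) hbad
    have hne : ‖μ‖ ≠ W (rep x) := fun h => hx 0 (hW (hμ.symm.trans h))
    refine hne (hhom x hx0 fun q hq hqx => ?_)
    by_contra hq0
    have h1 := hlevel q hq hq0
    rw [hqx] at h1
    refine absurd (hxmax q ⟨hq0, fun k hk => hx (k + 1) ?_⟩) (not_le.2 h1)
    rw [iterate_succ_apply', hk, hq, ← hqx]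
  have hfle : ∀ k x, d (f^[k] x) ≤ d x := by
    intro k x
    induction k with
    | zero => exact le_rfl
    | succ k ih =>
      rw [iterate_succ_apply']
      exact (hmin _).trans ((hpar _).trans ih)
  -- If distinct, one would be an iterate under `f` of the common parent orbit, whose level is too
  -- low.
  have huniq : ∀ q q', rep q = q → rep q' = q' → v q ≠ 0 → v q' ≠ 0 → f q = f q' → q = q' := by
    intro q q' hq hq' hq0 hq0' hqq
    obtain ⟨k, hk⟩ := hanc q hq0
    obtain ⟨l, hl⟩ := hanc q' hq0'
    wlog hkl : k ≤ l generalizing q q' k l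
    · exact (this q' q hq' hq hq0' hq0 hqq.symm l hl k hk (by omega)).symm
    obtain ⟨j, rfl⟩ := Nat.exists_eq_add_of_le' hkl
    rw [iterate_add_apply, hk, hq, hq'] at hl
    rcases j with _ | j
    · exact hl
    · rw [iterate_succ_apply, hqq] at hl
      have h1 := hfle j (f q')
      rw [hl] at h1
      have h2 := hlevel q' hq' hq0'
      rw [hq'] at h2
      exact absurd h1 (not_le.2 h2)
  -- Round a partly supported orbit, `v` switches from nonzero to zero and back. Each switch needs a
  -- supported child, attached where `v` is nonzero in one case and zero in the other; but there is
  -- only one such child.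
  have hall : ∀ x y, rep x = rep y → v x ≠ 0 → v y ≠ 0 := by
    intro x y hxy hx hy
    obtain ⟨k, hk⟩ := hreach x y hxy
    obtain ⟨l, hl⟩ := hreach y x hxy.symm
    obtain ⟨i, hi, hi'⟩ := exists_iterate_transition σ (fun t => v t ≠ 0) hx k (by simpa [hk])
    obtain ⟨j, hj, hj'⟩ := exists_iterate_transition σ (fun t => v t = 0) hy l (by simpa [hl])
    simp only [not_not] at hi'
    have ha := heq (σ^[i] x)
    have hb := heq (σ^[j] y)
    rw [hi', mul_zero, zero_add] at ha
    rw [hj, mul_zero] at hb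
    obtain ⟨q, hq, hqu, hq0⟩ := hchild (σ^[i] x) (ha ▸ mul_ne_zero hμ0 hi)
    obtain ⟨q', hq', hqu', hq0'⟩ := hchild (σ^[j] y) fun h0 => by
      rw [h0, add_zero] at hb
      exact mul_ne_zero (by exact_mod_cast (hWpos _).ne') hj' hb.symm
    have : q = q' := huniq q q' hq hq' hq0 hq0' (by
      simp only [hf, hqu, hqu', hiter, hxy])
    subst this
    rw [← hqu, hqu'] at hi
    exact hi hj
  -- The lowest supported orbit hangs from an unsupported one, where the equation reduces to `v (rep
  -- y) = 0`.
  obtain ⟨y, hy0, hymin⟩ := Set.exists_min_image {x | v x ≠ 0} (fun x => d (rep x))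
    (Set.toFinite _) ⟨x₀, hx₀⟩
  have hrr : rep (rep y) = rep y := (hrep' _ _ (hrep y)).symm
  have ho : v (rep y) ≠ 0 := hall y _ hrr.symm hy0
  have hzero : ∀ t, rep t = rep (par (rep y)) → v t = 0 := by
    intro t ht
    by_contra ht0
    have h1 := hlevel _ hrr ho
    rw [hrr, ← ht] at h1
    exact absurd (hymin t ht0) (not_le.2 h1)
  have h := heq (par (rep y))
  rw [hzero _ rfl, hzero (σ _) (hiter _ 1), mul_zero, mul_zero, zero_add,
    Finset.sum_eq_single (rep y)] at h
  · exact ho h.symm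
  · intro q hq hne
    simp only [Finset.mem_filter, Finset.mem_univ, true_and] at hq
    by_contra hq0
    exact hne (huniq q _ hq.1 hrr hq0 ho (by simp only [hf, hq.2]))
  · intro hnot
    exact absurd (by simpa using hrr) hnot

/-! ### Constructing a controllable realization -/

theorem exists_orbit_representatives {V : Type*} (σ : Equiv.Perm V) (d : V → ℕ) :
    ∃ rep : V → V, (∀ x, σ.SameCycle x (rep x)) ∧ (∀ x y, σ.SameCycle x y → rep x = rep y) ∧
      ∀ x, d (rep x) ≤ d x := by
  let st := Equiv.Perm.SameCycle.setoid σ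
  have h : ∀ Q : Quotient st, ∃ x, Quotient.mk st x = Q ∧ ∀ y, Quotient.mk st y = Q → d x ≤ d y := by
    intro Q
    obtain ⟨x, hx, hmin⟩ := (measure d).wf.has_min {y | Quotient.mk st y = Q} Q.exists_rep
    exact ⟨x, hx, fun y hy => not_lt.1 (hmin y hy)⟩
  choose g hg hg' using h
  refine ⟨fun x => g (Quotient.mk st x), fun x => ?_, fun x y hxy => ?_, fun x => hg' _ x rfl⟩
  · exact Equiv.Perm.SameCycle.symm (Quotient.exact (hg (Quotient.mk st x)))
  · exact congrArg g (Quotient.sound hxy)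

/-- The level counts the nodes of a shortest walk from an input node; deleting the last node
exhibits a lower predecessor. -/
theorem InputAccessible.exists_level {N : NetworkSystem n m} (hN : N.InputAccessible) :
    ∃ d : Fin n ⊕ Fin m → ℕ, ∀ i, ∃ u, N.graph.Adj u (Sum.inl i) ∧ d u < d (Sum.inl i) := by
  classical
  let P : Fin n ⊕ Fin m → ℕ → Prop := fun x k => ∃ p : List (Fin n ⊕ Fin m), p.length = k ∧
    p.IsChain N.graph.Adj ∧ (∃ s, p.head? = some (Sum.inr s)) ∧ p.getLast? = some x
  have hP : ∀ x, ∃ k, P x k := by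
    rintro (i | s)
    · obtain ⟨p, ⟨s, -, hc, hh, -⟩, hl⟩ := hN i
      exact ⟨_, p, rfl, hc, ⟨s, hh⟩, hl⟩
    · exact ⟨_, [Sum.inr s], rfl, by simp, ⟨s, rfl⟩, rfl⟩
  refine ⟨fun x => Nat.find (hP x), fun i => ?_⟩
  obtain ⟨p, hlen, hc, ⟨s, hh⟩, hl⟩ := Nat.find_spec (hP (Sum.inl i))
  obtain ⟨q, rfl⟩ := List.getLast?_eq_some_iff.1 hl
  rcases List.eq_nil_or_concat' q with rfl | ⟨q, u, rfl⟩
  · simp at hh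
  · refine ⟨u, ?_, ?_⟩
    · exact List.isChain_pair.1 (hc.infix ⟨q, [], by simp⟩)
    · refine (Nat.find_min' (hP u) (m := (q ++ [u]).length)
        ⟨_, rfl, hc.left_of_append, ⟨s, ?_⟩, by simp⟩).trans_lt ?_
      · simpa using hh
      · change _ < Nat.find (hP _)
        rw [← hlen]
        simp

theorem structurallyControllable_of_isSuccessorPerm (hN : N.InputAccessible)
    {σ : Equiv.Perm (Fin n ⊕ Fin m)} (hσ : N.IsSuccessorPerm σ) :
    N.StructurallyControllable := by
  obtain ⟨d, hd⟩ := hN.exists_level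
  choose par₀ hadj hlt using hd
  obtain ⟨rep, hrep, hrep', hmin⟩ := exists_orbit_representatives σ d
  -- The value at input nodes is a dummy: their rows in `M` only ever meet zero entries of `v'`.
  let par : Fin n ⊕ Fin m → Fin n ⊕ Fin m := Sum.elim par₀ Sum.inr
  let W : Fin n ⊕ Fin m → ℝ := fun x => (Fintype.equivFin _ x : ℕ) + 1
  have hW : Injective W := fun x y h => by
    apply (Fintype.equivFin (Fin n ⊕ Fin m)).injective
    apply Fin.ext
    exact_mod_cast add_right_cancel h
  let M : Fin n ⊕ Fin m → Fin n ⊕ Fin m → ℝ := fun x u =>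
    (if σ u = x then W (rep u) else 0) + if rep x = x ∧ par x = u then 1 else 0
  have hM : ∀ i u, ¬ N.graph.Adj u (Sum.inl i) → M (Sum.inl i) u = 0 := by
    intro i u hu
    have h1 : σ u ≠ Sum.inl i := fun h => hu (hσ u i h)
    have h2 : par (Sum.inl i) ≠ u := fun h => hu (h ▸ hadj i)
    simp [M, h1, h2]
  refine ⟨Matrix.of fun i j => M (Sum.inl i) (Sum.inl j),
    Matrix.of fun i s => M (Sum.inl i) (Sum.inr s), ⟨?_, ?_, ?_⟩, ?_⟩
  · exact fun i => hM i _ fun h => h.1 rfl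
  · exact fun i j hij => hM i _ fun h => hij h.2
  · exact fun i s his => hM i _ his
  apply rank_controllabilityMatrix_eq_of_eigenvector_test
  intro μ v hA hB
  let v' : Fin n ⊕ Fin m → ℂ := Sum.elim v 0
  have heq : ∀ u, μ * v' u = ∑ x, v' x * M x u := by
    intro u
    rw [Fintype.sum_sum_type]
    simp only [v', Sum.elim_inl, Sum.elim_inr, Pi.zero_apply, zero_mul, Finset.sum_const_zero,
      add_zero]
    rcases u with j | s
    · exact (congrFun hA j).symm
    · rw [Sum.elim_inr, Pi.zero_apply, mul_zero]
      exact (congrFun hB s).symm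
  have hv' : v' = 0 := by
    refine eq_zero_of_forest_of_cycles σ rep par d W v' μ hrep hrep' hmin hW
      (fun x => by positivity) ?_ ?_ fun u => ?_
    · rintro (i | s)
      · exact (hlt i).le
      · exact le_rfl
    · rintro (i | s) hx
      · exact hlt i
      · exact absurd rfl hx
    · rw [heq u, Finset.sum_filter]
      simp only [M, Complex.ofReal_add, mul_add, Finset.sum_add_distrib]
      congr 1
      · rw [Finset.sum_eq_single (σ u)]
        · simp [mul_comm]
        · intro x _ hx
          simp [hx.symm]
        · simp
      · refine Finset.sum_congr rfl fun x _ => ?_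
        split_ifs <;> simp
  ext i
  exact congrFun hv' (Sum.inl i)

end NetworkSystem

theorem corollary1 {n m : ℕ} (N : NetworkSystem n m) (hN : N.InputAccessible) :
    ¬ N.StructurallyControllable ↔
      ∀ (S : Set (List (Fin n ⊕ Fin m))) (C : Set (Cycle (Fin n ⊕ Fin m))),
        N.IsStemCycleCover S C →
          (∃ p ∈ S, ∃ c ∈ C, ∃ w, w ∈ p ∧ w ∈ c) ∨
          (∃ c ∈ C, ∃ c' ∈ C, c ≠ c' ∧ ∃ w, w ∈ c ∧ w ∈ c') ∨
          (∃ p ∈ S, ∃ p' ∈ S, ∃ s s', s ≠ s' ∧ N.IsStemFrom s p ∧ N.IsStemFrom s' p' ∧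
            ∃ w, w ∈ p ∧ w ∈ p') ∨
          (∃ p ∈ S, ∃ p' ∈ S, p ≠ p' ∧ ∃ s, N.IsStemFrom s p ∧ N.IsStemFrom s p') := by
  change _ ↔ ∀ S C, N.IsStemCycleCover S C → N.HasConflict S C
  constructor
  · intro h S C hSC
    by_contra hnc
    obtain ⟨σ, hσ⟩ := N.exists_isSuccessorPerm_of_cover hSC hnc
    exact h (N.structurallyControllable_of_isSuccessorPerm hN hσ)
  · intro h hctrl
    obtain ⟨σ, hσ⟩ := hctrl.exists_isSuccessorPerm
    obtain ⟨S, C, hSC, hnc⟩ := N.exists_cover_of_isSuccessorPerm hσ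
    exact hnc (h S C hSC)
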